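/- Let $g$ be a Hermitian $\ell 2$-structure on a finite set $V$ with $n$ elements, that is, a map assigning to every ordered pair $(x,y)$ of distinct elements of $V$ a complex number $g(x,y)$ such that $g(x,y)=\overline{g(y,x)}$. For $X\subseteq V$, the substructure $g[X]$ is the restriction of $g$ to pairs of distinct elements of $X$; its characteristic polynomial is that of its adjacency matrix (zero diagonal, entry $g(x,y)$ at $(x,y)$ for $x\ne y$). The structure $g$ is $k$-spectrally monomorphic if all $g[X]$ with $|X|=k$ have the same characteristic polynomial. Structures $g,g'$ on $V$ are equivalent if there is $\delta:V\to\mathbb{C}\setminus\{0\}$ with $|\delta|$ constant and $g'(x,y)=\delta(x)g(x,y)\overline{\delta(y)}$ for all $x\neq y$. For a non-real complex number $c$ with $|c|=1$ (for instance $c=i$), the $c$-representation of a tournament on $V$ is the structure equal to $c$ at $(x,y)$ if $x$ dominates $y$ and to $\overline{c}$ otherwise. A tournament is doubly regular if there is $t>0$ such that every pair of distinct vertices is dominated by exactly $t$ vertices, and $\widehat{T}$ denotes the tournament obtained from a tournament $T$ by adding a new vertex that dominates every vertex of $T$. **Theorem.** If $n\geq 7$, then $g$ is $(n-3)$-spectrally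 monomorphic if and only if $g$ is equivalent to one of the following: 1. a real constant structure ($g'(x,y)=r$ for all $x\ne y$, with $r\in\mathbb{R}$); 2. a $c$-representation of a transitive tournament on $V$, for some non-real $c\in\mathbb{C}$ with $|c|=1$; 3. an $i$-representation of a tournament on $V$ isomorphic to $\widehat{T}$, where $T$ is a doubly regular tournament of order $n-1$. The "if" direction holds for $n=6$ as well. -/

import Mathlib

open scoped ComplexConjugate

universe u v

/-- A labeled 2-structure on `V` with label set `C`: a map assigning a label to every ordered
pair of distinct vertices. -/
def L2Structure (V : Type u) (C : Type v) : Type (max u v) :=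
  (x y : V) → x ≠ y → C

namespace L2Structure

/-- The substructure `g[X]` induced by a finite set `X` of vertices. -/
def induce {V : Type u} {C : Type v} (g : L2Structure V C) (X : Finset V) : L2Structure X C :=
  fun x y h => g x.1 y.1 (fun e => h (Subtype.ext e))

/-- The adjacency matrix of a complex structure, indexed by the vertices. -/
def adjMatrix {V : Type u} [DecidableEq V] (g : L2Structure V ℂ) : Matrix V V ℂ :=
  Matrix.of fun x y => if h : x = y then 0 else g x y h

/-- The characteristic polynomial `det (x I - M)` of the adjacency matrix `M`. -/
noncomputable def charPoly {V : Type u} [Fintype V] [DecidableEq V] (g : L2Structure V ℂ) :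
    Polynomial ℂ :=
  g.adjMatrix.charpoly

/-- All induced substructures with `k` vertices have the same characteristic polynomial. -/
def SpectrallyMonomorphic {V : Type u} [DecidableEq V] (k : ℕ) (g : L2Structure V ℂ) : Prop :=
  ∀ X Y : Finset V, X.card = k → Y.card = k → (g.induce X).charPoly = (g.induce Y).charPoly

def IsHermitian {V : Type u} (g : L2Structure V ℂ) : Prop :=
  ∀ (x y : V) (h : x ≠ y), g x y h = conj (g y x h.symm)

/-- A selector: a nowhere zero complex function on the vertices, of constant modulus. -/
def IsSelector {V : Type u} (δ : V → ℂ) : Prop :=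
  (∀ x, δ x ≠ 0) ∧ ∀ x y, ‖δ x‖ = ‖δ y‖

/-- The structure `g^δ`. -/
noncomputable def scale {V : Type u} (g : L2Structure V ℂ) (δ : V → ℂ) : L2Structure V ℂ :=
  fun x y h => δ x * g x y h * conj (δ y)

/-- The equivalence `g ∼ g'`: there is a selector `δ` with `g' = g^δ`. -/
def Equivalent {V : Type u} (g g' : L2Structure V ℂ) : Prop :=
  ∃ δ : V → ℂ, IsSelector δ ∧ g' = g.scale δ

/-- The structure all of whose labels are equal to the real number `r`. -/
def realConst (V : Type u) (r : ℝ) : L2Structure V ℂ :=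
  fun _ _ _ => (r : ℂ)

end L2Structure

/-- A tournament on `V`; `Dom x y` means that `x` dominates `y`. -/
structure Tournament (V : Type u) where
  Dom : V → V → Prop
  irrefl : ∀ x, ¬ Dom x x
  dom_iff : ∀ x y, x ≠ y → (Dom x y ↔ ¬ Dom y x)

namespace Tournament

def IsTransitive {V : Type u} (T : Tournament V) : Prop :=
  ∀ x y z, T.Dom x y → T.Dom y z → T.Dom x z

/-- There is `t > 0` such that every pair of distinct vertices is dominated by exactly `t`
vertices. -/
def IsDoublyRegular {V : Type u} (T : Tournament V) : Prop :=
  ∃ t : ℕ, 0 < t ∧ ∀ x y, x ≠ y → {z | T.Dom z x ∧ T.Dom z y}.ncard = t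

/-- The tournament obtained from `T` by adding a vertex `none` that dominates every vertex
of `T`. -/
def hat {V : Type u} (T : Tournament V) : Tournament (Option V) where
  Dom
    | none, some _ => True
    | some x, some y => T.Dom x y
    | _, none => False
  irrefl := by
    rintro (_ | x)
    · exact id
    · exact T.irrefl x
  dom_iff := by
    rintro (_ | x) (_ | y) h
    · exact absurd rfl h
    · exact ⟨fun _ => id, fun _ => trivial⟩
    · exact ⟨False.elim, fun h => h trivial⟩
    · exact T.dom_iff x y (fun e => h (congrArg some e))

/-- Two tournaments are isomorphic. -/
def Isomorphic {V : Type u} {W : Type v} (T : Tournament V) (R : Tournament W) : Prop :=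
  ∃ σ : V ≃ W, ∀ x y, T.Dom x y ↔ R.Dom (σ x) (σ y)

open Classical in
/-- The `c`-representation of a tournament: label `c` on `(x, y)` if `x` dominates `y`, and
the conjugate of `c` otherwise. -/
noncomputable def rep {V : Type u} (T : Tournament V) (c : ℂ) : L2Structure V ℂ :=
  fun x y _ => if T.Dom x y then c else conj c

end Tournament

/-- `g` is equivalent to a real constant structure, or to a `c`-representation of a transitive
tournament (`c` a non-real unit complex number), or to an `i`-representation of (a copy on the
vertex set of `g` of) the tournament obtained by adding a dominating vertex to a doubly regular
tournament whose order is one less than that of `g`. -/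
def L2Structure.InList {V : Type u} [Fintype V] (g : L2Structure V ℂ) : Prop :=
  (∃ r : ℝ, g.Equivalent (L2Structure.realConst V r)) ∨
  (∃ (c : ℂ) (T : Tournament V), ‖c‖ = 1 ∧ c.im ≠ 0 ∧ T.IsTransitive ∧ g.Equivalent (T.rep c)) ∨
  (∃ (T : Tournament (Fin (Fintype.card V - 1))) (R : Tournament V),
    T.IsDoublyRegular ∧ R.Isomorphic T.hat ∧ g.Equivalent (R.rep Complex.I))

/-! Coefficients of characteristic polynomials are signed sums of principal minors, so spectral
monomorphy says that for each `p ≤ n - 3` the sum of the `p`-minors inside an `(n - 3)`-set does not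
depend on the set. Double counting carries this to larger sets. Inclusion–exclusion then shows that
the sum of the `p`-minors over the `p`-sets containing a given pair or triple is constant.

For the forward direction, `p = 2` makes `|g(x,y)|` constant and `p = 3` makes `Re(g(x,y) g(y,z)
g(z,x))` constant. Fix a vertex `v`. Rescaling by its row gives entries `c` or `conj c` with `|c| =
1` (unless `g` is zero), and row `v` constantly `c` (`exists_normalized`). If `c` is real, `g` is
equivalent to a constant; otherwise the entries encode a tournament dominated by `v`. A `3`-cycle in
it forces `Re(c^3) = Re(c)`, hence `c = i`. Now `p = 4`, the only place where `n ≥ 7` is needed, and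
the Pfaffian show that all arcs away from `v` lie in equally many `3`-cycles. This number is
positive, so removing `v` leaves a doubly regular tournament (`isDoublyRegular_of_homogeneous`).

Conversely, in the constant and transitive cases all `k`-subsets induce isomorphic structures. In
the doubly regular case the adjacency matrix `H` satisfies `H² = (n - 1) I`. Jacobi's identity
(`charpoly_submatrix_compl_mul`) expresses the polynomial of an `(n - 3)`-subset through that of its
`3`-element complement, which is always `X³ - 3X`. -/

section SubsetSums

/-! ### Sums over `p`-subsets: double counting and inclusion–exclusion -/

variable {V : Type u} [DecidableEq V] (f : Finset V → ℂ) {p k : ℕ}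

theorem powersetCard_erase_eq_filter (X : Finset V) (x : V) (p : ℕ) :
    (X.erase x).powersetCard p = (X.powersetCard p).filter (fun P => x ∉ P) := by
  ext P
  simp only [Finset.mem_powersetCard, Finset.mem_filter, Finset.subset_erase]
  tauto

theorem sum_sum_powersetCard_erase (X : Finset V) (p : ℕ) :
    ∑ x ∈ X, ∑ P ∈ (X.erase x).powersetCard p, f P =
      ((X.card : ℂ) - p) * ∑ P ∈ X.powersetCard p, f P := by
  simp_rw [powersetCard_erase_eq_filter, Finset.sum_filter]
  rw [Finset.sum_comm, Finset.mul_sum]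
  refine Finset.sum_congr rfl fun P hP => ?_
  obtain ⟨hPX, hc⟩ := Finset.mem_powersetCard.1 hP
  rw [← Finset.sum_filter, Finset.sum_const, Finset.filter_notMem_eq_sdiff,
    Finset.card_sdiff_of_subset hPX, hc, nsmul_eq_mul, Nat.cast_sub]
  rw [← hc]
  exact Finset.card_le_card hPX

/-- The sum of `f` over the `p`-subsets of `X` depends only on the size of `X`, for `X` of
size `k`. -/
def SubsetSumConst (p k : ℕ) : Prop :=
  ∃ N : ℂ, ∀ X : Finset V, X.card = k → ∑ P ∈ X.powersetCard p, f P = N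

variable {f}

/-- Delete each point of a `(k + 1)`-set in turn: every `p`-subset survives exactly `k + 1 - p`
deletions, a nonzero number because `p ≤ k`. -/
theorem SubsetSumConst.succ (h : SubsetSumConst f p k) (hp : p ≤ k) :
    SubsetSumConst f p (k + 1) := by
  obtain ⟨N, hN⟩ := h
  refine ⟨((k + 1 : ℂ) * N) / (k + 1 - p), fun X hX => ?_⟩
  have h1 := sum_sum_powersetCard_erase f X p
  rw [Finset.sum_congr rfl fun x hx => hN (X.erase x) (by
    rw [Finset.card_erase_of_mem hx, hX]; rfl)] at h1
  have h2 : (k + 1 - p : ℂ) ≠ 0 := by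
    have : ((k + 1 - p : ℕ) : ℂ) ≠ 0 := by
      rw [Nat.cast_ne_zero]; omega
    rwa [Nat.cast_sub (by omega), Nat.cast_add, Nat.cast_one] at this
  rw [Finset.sum_const, hX, nsmul_eq_mul] at h1
  push_cast at h1
  rw [eq_div_iff h2, h1]
  ring

variable [Fintype V]

/-- Inclusion–exclusion on the sets avoiding `x`, avoiding `y`, or avoiding both. -/
theorem SubsetSumConst.contains_pair (h0 : SubsetSumConst f p (Fintype.card V))
    (h1 : SubsetSumConst f p (Fintype.card V - 1)) (h2 : SubsetSumConst f p (Fintype.card V - 2)) :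
    ∃ K : ℂ, ∀ x y : V, x ≠ y →
      ∑ P ∈ (Finset.univ.powersetCard p).filter (fun P => x ∈ P ∧ y ∈ P), f P = K := by
  obtain ⟨N0, h0⟩ := h0
  obtain ⟨N1, h1⟩ := h1
  obtain ⟨N2, h2⟩ := h2
  refine ⟨N0 - N1 - N1 + N2, fun x y hxy => ?_⟩
  have e0 := h0 Finset.univ rfl
  have ex := h1 (Finset.univ.erase x) (by simp [Finset.card_erase_of_mem])
  have ey := h1 (Finset.univ.erase y) (by simp [Finset.card_erase_of_mem])
  have exy := h2 ((Finset.univ.erase x).erase y) (by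
    rw [Finset.card_erase_of_mem (by simp [hxy.symm]), Finset.card_erase_of_mem (by simp)]
    simp [Nat.sub_sub])
  rw [← e0]
  -- One copy of `N1` must become the sum avoiding `x` and the other the sum avoiding `y`.
  rw [← ex]
  nth_rw 2 [ex]
  rw [← ey, ← exy]
  simp only [powersetCard_erase_eq_filter, Finset.filter_filter, Finset.sum_filter]
  rw [← Finset.sum_sub_distrib, ← Finset.sum_sub_distrib, ← Finset.sum_add_distrib]
  refine Finset.sum_congr rfl fun P _ => ?_
  by_cases hx : x ∈ P <;> by_cases hy : y ∈ P <;> simp [hx, hy]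

theorem SubsetSumConst.contains_triple (h0 : SubsetSumConst f p (Fintype.card V))
    (h1 : SubsetSumConst f p (Fintype.card V - 1)) (h2 : SubsetSumConst f p (Fintype.card V - 2))
    (h3 : SubsetSumConst f p (Fintype.card V - 3)) :
    ∃ K : ℂ, ∀ x y z : V, x ≠ y → x ≠ z → y ≠ z →
      ∑ P ∈ (Finset.univ.powersetCard p).filter (fun P => x ∈ P ∧ y ∈ P ∧ z ∈ P), f P = K := by
  obtain ⟨N0, h0⟩ := h0
  obtain ⟨N1, h1⟩ := h1
  obtain ⟨N2, h2⟩ := h2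
  obtain ⟨N3, h3⟩ := h3
  have c1 : ∀ x : V, ∑ P ∈ Finset.univ.powersetCard p, (if x ∉ P then f P else 0) = N1 := by
    intro x
    rw [← h1 (Finset.univ.erase x) (by simp [Finset.card_erase_of_mem]),
      powersetCard_erase_eq_filter, Finset.sum_filter]
  have c2 : ∀ x y : V, x ≠ y →
      ∑ P ∈ Finset.univ.powersetCard p, (if x ∉ P ∧ y ∉ P then f P else 0) = N2 := by
    intro x y hxy
    rw [← h2 ((Finset.univ.erase x).erase y) (by
      rw [Finset.card_erase_of_mem (by simp [hxy.symm]), Finset.card_erase_of_mem (by simp)]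
      simp [Nat.sub_sub]), powersetCard_erase_eq_filter, powersetCard_erase_eq_filter,
      Finset.filter_filter, Finset.sum_filter]
  have c3 : ∀ x y z : V, x ≠ y → x ≠ z → y ≠ z →
      ∑ P ∈ Finset.univ.powersetCard p, (if (x ∉ P ∧ y ∉ P) ∧ z ∉ P then f P else 0) = N3 := by
    intro x y z hxy hxz hyz
    rw [← h3 (((Finset.univ.erase x).erase y).erase z) (by
      rw [Finset.card_erase_of_mem (by simp [hxz.symm, hyz.symm]),
        Finset.card_erase_of_mem (by simp [hxy.symm]), Finset.card_erase_of_mem (by simp)]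
      simp [Nat.sub_sub]), powersetCard_erase_eq_filter, powersetCard_erase_eq_filter,
      powersetCard_erase_eq_filter,
      Finset.filter_filter, Finset.filter_filter, Finset.sum_filter]
    simp only [and_assoc]
  refine ⟨N0 - N1 - N1 - N1 + N2 + N2 + N2 - N3, fun x y z hxy hxz hyz => ?_⟩
  have e : ∑ P ∈ (Finset.univ.powersetCard p).filter (fun P => x ∈ P ∧ y ∈ P ∧ z ∈ P), f P =
      ∑ P ∈ Finset.univ.powersetCard p, (f P - (if x ∉ P then f P else 0)
        - (if y ∉ P then f P else 0) - (if z ∉ P then f P else 0)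
        + (if x ∉ P ∧ y ∉ P then f P else 0) + (if x ∉ P ∧ z ∉ P then f P else 0)
        + (if y ∉ P ∧ z ∉ P then f P else 0)
        - (if (x ∉ P ∧ y ∉ P) ∧ z ∉ P then f P else 0)) := by
    rw [Finset.sum_filter]
    refine Finset.sum_congr rfl fun P _ => ?_
    by_cases hx : x ∈ P <;> by_cases hy : y ∈ P <;> by_cases hz : z ∈ P <;> simp [hx, hy, hz]
  rw [e]
  simp only [Finset.sum_sub_distrib, Finset.sum_add_distrib]
  rw [c1, c1, c1, c2 x y hxy, c2 x z hxz, c2 y z hyz, c3 x y z hxy hxz hyz, h0 Finset.univ rfl]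

end SubsetSums

/-! ### Principal minors and characteristic polynomial coefficients -/

section Minors

variable {V : Type u} [DecidableEq V]

/-- The determinant of the principal submatrix of `M` indexed by `P`. -/
noncomputable def principalMinor (M : Matrix V V ℂ) (P : Finset V) : ℂ :=
  (M.submatrix (Subtype.val : P → V) (Subtype.val : P → V)).det

theorem charpoly_submatrix_coeff (M : Matrix V V ℂ) (X : Finset V) (p : ℕ) (hp : p ≤ X.card) :
    (M.submatrix (Subtype.val : X → V) (Subtype.val : X → V)).charpoly.coeff (X.card - p) =
      (-1) ^ p * ∑ P ∈ X.powersetCard p, principalMinor M P := by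
  have h := Matrix.charpoly_coeff_eq_sum_minors
    (M.submatrix (Subtype.val : X → V) (Subtype.val : X → V)) p (by simpa using hp)
  rw [Fintype.card_coe] at h
  rw [h]
  congr 1
  have e : X.powersetCard p = ((Finset.univ : Finset X).powersetCard p).map
      (Finset.mapEmbedding (Function.Embedding.subtype _)).toEmbedding := by
    rw [← Finset.powersetCard_map]
    congr 1
    exact (Finset.attach_map_val (s := X)).symm
  rw [e, Finset.sum_map]
  refine Finset.sum_congr rfl fun s _ => ?_
  let e' : s ≃ s.map (Function.Embedding.subtype (fun x => x ∈ X)) := Equiv.ofBijective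
    (fun i => ⟨i.1.1, Finset.mem_map_of_mem _ i.2⟩)
    ⟨fun i j h => Subtype.ext (Subtype.ext (Subtype.mk.inj h)), fun ⟨y, hy⟩ => by
      obtain ⟨i, hi, rfl⟩ := Finset.mem_map.1 hy
      exact ⟨⟨i, hi⟩, rfl⟩⟩
  exact Matrix.det_submatrix_equiv_self e' (M.submatrix Subtype.val Subtype.val)

theorem charpoly_submatrix_eq_iff (M : Matrix V V ℂ) {X Y : Finset V} {k : ℕ} (hX : X.card = k)
    (hY : Y.card = k) :
    (M.submatrix (Subtype.val : X → V) (Subtype.val : X → V)).charpoly =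
        (M.submatrix (Subtype.val : Y → V) (Subtype.val : Y → V)).charpoly ↔
      ∀ p ≤ k, ∑ P ∈ X.powersetCard p, principalMinor M P =
        ∑ P ∈ Y.powersetCard p, principalMinor M P := by
  constructor
  · intro h p hp
    have h1 := charpoly_submatrix_coeff M X p (hX ▸ hp)
    have h2 := charpoly_submatrix_coeff M Y p (hY ▸ hp)
    rw [h, hX, ← hY, h2] at h1
    exact (mul_left_cancel₀ (pow_ne_zero _ (by norm_num)) h1).symm
  · intro h
    ext j
    by_cases hj : j ≤ k
    · have h1 := charpoly_submatrix_coeff M X (k - j) (by omega)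
      have h2 := charpoly_submatrix_coeff M Y (k - j) (by omega)
      rw [hX, Nat.sub_sub_self hj] at h1
      rw [hY, Nat.sub_sub_self hj] at h2
      rw [h1, h2, h _ (by omega)]
    · rw [Polynomial.coeff_eq_zero_of_natDegree_lt, Polynomial.coeff_eq_zero_of_natDegree_lt]
      · rw [Matrix.charpoly_natDegree_eq_dim, Fintype.card_coe]; omega
      · rw [Matrix.charpoly_natDegree_eq_dim, Fintype.card_coe]; omega

theorem principalMinor_eq_of_enum (M : Matrix V V ℂ) {P : Finset V} {p : ℕ} (e : Fin p ≃ P) :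
    principalMinor M P = (Matrix.of fun i j => M (e i) (e j)).det := by
  rw [principalMinor, ← Matrix.det_submatrix_equiv_self e]
  rfl

/-- Listing the vertices by `Fin p` gives access to the explicit formulas for small determinants. -/
theorem principalMinor_image (M : Matrix V V ℂ) {p : ℕ} (v : Fin p → V)
    (hv : Function.Injective v) :
    principalMinor M (Finset.univ.image v) = (Matrix.of fun i j => M (v i) (v j)).det := by
  let e : Fin p ≃ Finset.univ.image v := Equiv.ofBijective
    (fun i => ⟨v i, Finset.mem_image_of_mem _ (Finset.mem_univ i)⟩)
    ⟨fun i j h => hv (congrArg Subtype.val h), fun ⟨y, hy⟩ => by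
      obtain ⟨i, -, rfl⟩ := Finset.mem_image.1 hy
      exact ⟨i, rfl⟩⟩
  exact principalMinor_eq_of_enum M e

theorem principalMinor_pair (M : Matrix V V ℂ) {x y : V} (h : x ≠ y) :
    principalMinor M {x, y} = M x x * M y y - M x y * M y x := by
  have := principalMinor_image M ![x, y] (by
    intro i j; fin_cases i <;> fin_cases j <;> simp [h, h.symm])
  rw [show (Finset.univ.image ![x, y]) = {x, y} by
    ext z; simp [Fin.exists_fin_succ, eq_comm]] at this
  rw [this, Matrix.det_fin_two]
  simp

theorem principalMinor_triple (M : Matrix V V ℂ) {x y z : V} (hxy : x ≠ y) (hxz : x ≠ z)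
    (hyz : y ≠ z) :
    principalMinor M {x, y, z} = M x x * M y y * M z z - M x x * M y z * M z y -
      M x y * M y x * M z z + M x y * M y z * M z x + M x z * M y x * M z y -
      M x z * M y y * M z x := by
  have := principalMinor_image M ![x, y, z] (by
    intro i j; fin_cases i <;> fin_cases j <;> simp [hxy, hxy.symm, hxz, hxz.symm, hyz, hyz.symm])
  rw [show (Finset.univ.image ![x, y, z]) = {x, y, z} by
    ext z; simp [Fin.exists_fin_succ, eq_comm]] at this
  rw [this, Matrix.det_fin_three]
  simp

/-- The Pfaffian formula for `4 × 4` matrices of the form `i S`, `S` skew-symmetric. -/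
theorem principalMinor_quadruple (M : Matrix V V ℂ) (hd : ∀ x, M x x = 0)
    (hs : ∀ x y, M y x = - M x y) {x y z w : V} (hxy : x ≠ y) (hxz : x ≠ z)
    (hxw : x ≠ w) (hyz : y ≠ z) (hyw : y ≠ w) (hzw : z ≠ w) :
    principalMinor M {x, y, z, w} =
      (M x y * M z w - M x z * M y w + M x w * M y z) ^ 2 := by
  have := principalMinor_image M ![x, y, z, w] (by
    intro i j
    fin_cases i <;> fin_cases j <;> simp [hxy, hxy.symm, hxz, hxz.symm, hyz, hyz.symm,
      hxw, hxw.symm, hyw, hyw.symm, hzw, hzw.symm])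
  rw [show (Finset.univ.image ![x, y, z, w]) = {x, y, z, w} by
    ext z; simp [Fin.exists_fin_succ, eq_comm]] at this
  rw [this]
  simp only [Matrix.det_succ_row_zero, Fin.sum_univ_succ]
  simp [Fin.succAbove]
  rw [hs x y, hs x z, hs x w, hs y z, hs y w, hs z w]
  simp [hd]
  ring

end Minors

/-! ### Invariance under equivalence; constant structures -/

namespace L2Structure

section Basic

variable {V : Type u}

theorem IsSelector.exists_mul_conj {δ : V → ℂ} (hδ : IsSelector δ) :
    ∃ s : ℂ, s ≠ 0 ∧ ∀ x, δ x * conj (δ x) = s := by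
  rcases isEmpty_or_nonempty V with h | ⟨⟨v⟩⟩
  · exact ⟨1, one_ne_zero, fun x => h.elim x⟩
  · refine ⟨((‖δ v‖ ^ 2 : ℝ) : ℂ), ?_, fun x => ?_⟩
    · simpa using hδ.1 v
    · rw [Complex.mul_conj, Complex.normSq_eq_norm_sq, hδ.2 x v]

variable [DecidableEq V]

theorem adjMatrix_self (g : L2Structure V ℂ) (x : V) : g.adjMatrix x x = 0 := by
  simp [adjMatrix]

theorem adjMatrix_of_ne (g : L2Structure V ℂ) {x y : V} (h : x ≠ y) :
    g.adjMatrix x y = g x y h := by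
  simp [adjMatrix, h]

theorem ext_adjMatrix {g g' : L2Structure V ℂ} (h : g.adjMatrix = g'.adjMatrix) : g = g' := by
  funext x y hxy
  have := congrFun (congrFun h x) y
  rwa [adjMatrix_of_ne _ hxy, adjMatrix_of_ne _ hxy] at this

theorem charPoly_induce (g : L2Structure V ℂ) (X : Finset V) :
    (g.induce X).charPoly =
      (g.adjMatrix.submatrix (Subtype.val : X → V) (Subtype.val : X → V)).charpoly := by
  rw [charPoly]
  congr 1
  ext x y
  by_cases h : x = y
  · subst h; simp [adjMatrix_self]
  · rw [adjMatrix_of_ne _ h, Matrix.submatrix_apply,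
      adjMatrix_of_ne _ (fun e => h (Subtype.ext e))]
    rfl

theorem spectrallyMonomorphic_iff (g : L2Structure V ℂ) (k : ℕ) :
    g.SpectrallyMonomorphic k ↔ ∀ X Y : Finset V, X.card = k → Y.card = k →
      ∀ p ≤ k, ∑ P ∈ X.powersetCard p, principalMinor g.adjMatrix P =
        ∑ P ∈ Y.powersetCard p, principalMinor g.adjMatrix P := by
  refine forall_congr' fun X => forall_congr' fun Y => forall_congr' fun hX =>
    forall_congr' fun hY => ?_
  rw [charPoly_induce, charPoly_induce, charpoly_submatrix_eq_iff _ hX hY]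

theorem adjMatrix_scale (g : L2Structure V ℂ) (δ : V → ℂ) (x y : V) :
    (g.scale δ).adjMatrix x y = δ x * (g.adjMatrix x y * conj (δ y)) := by
  by_cases h : x = y
  · subst h; simp [adjMatrix_self]
  · rw [adjMatrix_of_ne _ h, adjMatrix_of_ne _ h, scale, mul_assoc]

theorem principalMinor_scale (g : L2Structure V ℂ) {δ : V → ℂ} {s : ℂ}
    (hδ : ∀ x, δ x * conj (δ x) = s) (P : Finset V) :
    principalMinor (g.scale δ).adjMatrix P = s ^ P.card * principalMinor g.adjMatrix P := by
  have h : (g.scale δ).adjMatrix.submatrix (Subtype.val : P → V) (Subtype.val : P → V) =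
      Matrix.of fun x y : P => δ x * (Matrix.of fun x y : P => conj (δ y) *
        g.adjMatrix.submatrix (Subtype.val : P → V) (Subtype.val : P → V) x y) x y := by
    ext x y
    simp [adjMatrix_scale, mul_comm]
  rw [principalMinor, h, Matrix.det_mul_column, Matrix.det_mul_row, ← mul_assoc,
    ← Finset.prod_mul_distrib]
  simp [principalMinor, hδ]

/-- If `|δ|² = s`, every `p`-minor is multiplied by the same nonzero factor `s ^ p`, so equalities
between sums of `p`-minors are preserved. -/
theorem Equivalent.spectrallyMonomorphic_iff {g g' : L2Structure V ℂ} (h : g.Equivalent g')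
    (k : ℕ) : g'.SpectrallyMonomorphic k ↔ g.SpectrallyMonomorphic k := by
  obtain ⟨δ, hδ, rfl⟩ := h
  obtain ⟨s, hs, hδs⟩ := hδ.exists_mul_conj
  rw [L2Structure.spectrallyMonomorphic_iff, L2Structure.spectrallyMonomorphic_iff]
  have e : ∀ (X : Finset V) (p : ℕ),
      ∑ P ∈ X.powersetCard p, principalMinor (g.scale δ).adjMatrix P =
        s ^ p * ∑ P ∈ X.powersetCard p, principalMinor g.adjMatrix P := by
    intro X p
    rw [Finset.mul_sum]
    refine Finset.sum_congr rfl fun P hP => ?_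
    rw [principalMinor_scale g hδs, (Finset.mem_powersetCard.1 hP).2]
  simp only [e, mul_right_inj' (pow_ne_zero _ hs)]

theorem spectrallyMonomorphic_of_equiv (g : L2Structure V ℂ) (k : ℕ)
    (h : ∀ X Y : Finset V, X.card = k → Y.card = k → ∃ e : X ≃ Y, ∀ x y : X,
      g.adjMatrix (e x) (e y) = g.adjMatrix x y) : g.SpectrallyMonomorphic k := by
  intro X Y hX hY
  obtain ⟨e, he⟩ := h X Y hX hY
  rw [charPoly_induce, charPoly_induce, ← Matrix.charpoly_reindex e]
  congr 1
  ext x y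
  simp [← he]

theorem realConst_spectrallyMonomorphic (r : ℝ) (k : ℕ) :
    (realConst V r).SpectrallyMonomorphic k := by
  refine spectrallyMonomorphic_of_equiv _ k fun X Y hX hY => ?_
  have e : X ≃ Y := Fintype.equivOfCardEq (by simp [hX, hY])
  refine ⟨e, fun x y => ?_⟩
  simp [adjMatrix, realConst]

end Basic

end L2Structure

/-! ### Transitive tournaments -/

namespace Tournament

variable {V : Type u}

theorem Dom.ne {T : Tournament V} {x y : V} (h : T.Dom x y) : x ≠ y := by
  rintro rfl
  exact T.irrefl _ h

theorem Dom.not_dom {T : Tournament V} {x y : V} (h : T.Dom x y) : ¬ T.Dom y x :=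
  (T.dom_iff x y h.ne).1 h

theorem dom_or_dom (T : Tournament V) {x y : V} (h : x ≠ y) : T.Dom x y ∨ T.Dom y x := by
  by_cases h' : T.Dom y x
  · exact Or.inr h'
  · exact Or.inl ((T.dom_iff x y h).2 h')

variable [DecidableEq V]

open Classical in
theorem adjMatrix_rep (T : Tournament V) (c : ℂ) (x y : V) :
    (T.rep c).adjMatrix x y = if x = y then 0 else if T.Dom x y then c else conj c := by
  simp [L2Structure.adjMatrix, rep]

theorem Dom.adjMatrix_rep {T : Tournament V} {x y : V} (h : T.Dom x y) (c : ℂ) :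
    (T.rep c).adjMatrix x y = c := by
  rw [Tournament.adjMatrix_rep, if_neg h.ne, if_pos h]

theorem Dom.adjMatrix_rep_symm {T : Tournament V} {x y : V} (h : T.Dom x y) (c : ℂ) :
    (T.rep c).adjMatrix y x = conj c := by
  rw [Tournament.adjMatrix_rep, if_neg h.ne.symm, if_neg h.not_dom]

open Classical in
/-- The linear order of a transitive tournament. -/
@[reducible]
noncomputable def IsTransitive.linearOrder {T : Tournament V} (hT : T.IsTransitive) :
    LinearOrder V where
  le x y := x = y ∨ T.Dom x y
  le_refl x := Or.inl rfl
  le_trans x y z := by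
    rintro (rfl | h) (rfl | h')
    · exact Or.inl rfl
    · exact Or.inr h'
    · exact Or.inr h
    · exact Or.inr (hT _ _ _ h h')
  le_antisymm x y := by
    rintro (rfl | h) (h' | h')
    · rfl
    · rfl
    · exact h'.symm
    · exact absurd h' h.not_dom
  le_total x y := by
    by_cases h : x = y
    · exact Or.inl (Or.inl h)
    · exact (T.dom_or_dom h).imp Or.inr Or.inr
  toDecidableLE := inferInstance

/-- Two `k`-subsets of a linear order are order isomorphic, and the isomorphism preserves the
adjacency matrix. -/
theorem IsTransitive.rep_spectrallyMonomorphic {T : Tournament V} (hT : T.IsTransitive) (c : ℂ)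
    (k : ℕ) : (T.rep c).SpectrallyMonomorphic k := by
  refine L2Structure.spectrallyMonomorphic_of_equiv _ k fun X Y hX hY => ?_
  let _ := hT.linearOrder
  let e : X ≃o Y := (X.orderIsoOfFin hX).symm.trans (Y.orderIsoOfFin hY)
  refine ⟨e.toEquiv, fun x y => ?_⟩
  have key : ∀ a b : V, T.Dom a b ↔ a < b := by
    intro a b
    rw [lt_iff_le_and_ne]
    exact ⟨fun h => ⟨Or.inr h, h.ne⟩, fun h => h.1.resolve_left h.2⟩
  have h1 : (e x : V) < e y ↔ (x : V) < y := by
    rw [Subtype.coe_lt_coe, Subtype.coe_lt_coe]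
    exact e.lt_iff_lt
  have h2 : (e x : V) = e y ↔ (x : V) = y := by
    rw [Subtype.val_inj, Subtype.val_inj]
    exact e.injective.eq_iff
  simp only [adjMatrix_rep, key]
  exact if_congr h2 rfl (if_congr h1 rfl rfl)

end Tournament

/-! ### Jacobi's complementary minors for matrices with scalar square -/

section ComplementaryMinors

open Polynomial

variable {V : Type u} [Fintype V] [DecidableEq V]

theorem charmatrix_mul_charmatrix_neg {H : Matrix V V ℂ} {m : ℂ}
    (hsq : H * H = Matrix.scalar V m) :
    H.charmatrix * (-H).charmatrix = Matrix.scalar V (X ^ 2 - C m) := by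
  have h1 : H.map C * H.map C = Matrix.scalar V (C m) := by
    rw [← Matrix.map_mul, hsq]
    ext i j
    by_cases h : i = j <;> simp [h, Matrix.scalar_apply]
  have hc : Commute (Matrix.scalar V (X : ℂ[X])) (H.map C) :=
    Matrix.scalar_commute _ (fun _ => Commute.all _ _) _
  have h2 : (-H).charmatrix = Matrix.scalar V (X : ℂ[X]) + H.map C := by
    ext i j
    simp [Matrix.charmatrix]
  rw [h2, Matrix.charmatrix]
  change (Matrix.scalar V X - H.map C) * (Matrix.scalar V X + H.map C) = _
  rw [sub_mul, mul_add, mul_add, h1, hc.eq, map_sub, pow_two, map_mul]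
  abel

theorem det_eq_det_submatrix_of_one {R : Type*} [CommRing R] {K : Matrix V V R} (A : Finset V)
    (hK : ∀ i, ∀ j ∉ A, K i j = (1 : Matrix V V R) i j) :
    K.det = (K.submatrix (Subtype.val : A → V) Subtype.val).det := by
  rw [Matrix.twoBlockTriangular_det' K (fun i => i ∈ A)]
  · have h1 : (K.toSquareBlockProp fun i => ¬ i ∈ A) = 1 := by
      refine Matrix.ext fun i j => ?_
      rw [Matrix.toSquareBlockProp_def, Matrix.of_apply, hK _ _ j.2]
      rw [Matrix.one_apply, Matrix.one_apply]
      exact if_congr Subtype.val_inj rfl rfl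
    rw [h1, Matrix.det_one, mul_one]
    convert rfl
    rfl
  · intro i hi j hj
    have : i ≠ j := fun e => hj (e ▸ hi)
    rw [hK i j hj, Matrix.one_apply_ne this]

theorem det_eq_pow_mul_det_submatrix {R : Type*} [CommRing R] {K : Matrix V V R} (A : Finset V)
    {q : R} (hK : ∀ i, ∀ j ∈ A, K i j = Matrix.scalar V q i j) :
    K.det = q ^ A.card * (K.submatrix (Subtype.val : (Aᶜ : Finset V) → V) Subtype.val).det := by
  rw [Matrix.twoBlockTriangular_det K (fun i => i ∈ A)]
  · congr 1
    · have h1 : (K.toSquareBlockProp fun i => i ∈ A) = Matrix.scalar A q := by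
        refine Matrix.ext fun i j => ?_
        rw [Matrix.toSquareBlockProp_def, Matrix.of_apply, hK _ _ j.2]
        rw [Matrix.scalar_apply, Matrix.scalar_apply, Matrix.diagonal_apply,
          Matrix.diagonal_apply]
        exact if_congr Subtype.val_inj rfl rfl
      rw [h1]
      simp
    · let e : {i : V // ¬ i ∈ A} ≃ (Aᶜ : Finset V) :=
        Equiv.subtypeEquivRight fun i => Finset.mem_compl.symm
      exact Matrix.det_submatrix_equiv_self e
        (K.submatrix (Subtype.val : (Aᶜ : Finset V) → V) Subtype.val)
  · intro i hi j hj
    have : i ≠ j := fun e => hi (e ▸ hj)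
    simp [hK i j hj, this]

theorem charmatrix_submatrix_val {R : Type*} [CommRing R] (M : Matrix V V R) (A : Finset V) :
    M.charmatrix.submatrix (Subtype.val : A → V) Subtype.val =
      (M.submatrix (Subtype.val : A → V) Subtype.val).charmatrix := by
  refine Matrix.ext fun i j => ?_
  simp only [Matrix.submatrix_apply, Matrix.charmatrix_apply, Matrix.diagonal_apply]
  exact congrArg (· - _) (if_congr Subtype.val_inj rfl rfl)

/-- Jacobi's identity on complementary minors, for a matrix with scalar square. -/
theorem charpoly_submatrix_compl_mul {H : Matrix V V ℂ} {m : ℂ}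
    (hsq : H * H = Matrix.scalar V m) (A : Finset V) :
    (H.submatrix (Subtype.val : (Aᶜ : Finset V) → V) Subtype.val).charpoly
        * (X ^ 2 - C m) ^ A.card =
      H.charpoly * ((-H).submatrix (Subtype.val : A → V) Subtype.val).charpoly := by
  -- `K` has the columns of `X + H` on `A` and identity columns elsewhere. Then `(X - H) K` has the
  -- columns of `(X² - m) I` on `A` and those of `X - H` elsewhere, so taking determinants of the
  -- product gives the identity.
  obtain ⟨K, hKA, hKc⟩ : ∃ K : Matrix V V ℂ[X], (∀ i, ∀ j ∈ A, K i j = (-H).charmatrix i j) ∧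
      ∀ i, ∀ j ∉ A, K i j = (1 : Matrix V V ℂ[X]) i j :=
    ⟨Matrix.of fun i j => if j ∈ A then (-H).charmatrix i j else (1 : Matrix V V ℂ[X]) i j,
      fun i j hj => by simp [hj], fun i j hj => by simp [hj]⟩
  have hA : ∀ i, ∀ j ∈ A, (H.charmatrix * K) i j = Matrix.scalar V (X ^ 2 - C m) i j := by
    intro i j hj
    rw [← charmatrix_mul_charmatrix_neg hsq, Matrix.mul_apply, Matrix.mul_apply]
    exact Finset.sum_congr rfl fun z _ => by rw [hKA z j hj]
  have hc : ∀ i, ∀ j ∉ A, (H.charmatrix * K) i j = H.charmatrix i j := by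
    intro i j hj
    conv_rhs => rw [← mul_one H.charmatrix]
    rw [Matrix.mul_apply, Matrix.mul_apply]
    exact Finset.sum_congr rfl fun z _ => by rw [hKc z j hj]
  have h1 := det_eq_pow_mul_det_submatrix A hA
  rw [Matrix.det_mul, det_eq_det_submatrix_of_one A hKc] at h1
  have e1 : K.submatrix (Subtype.val : A → V) Subtype.val =
      ((-H).submatrix (Subtype.val : A → V) Subtype.val).charmatrix := by
    rw [← charmatrix_submatrix_val]
    exact Matrix.ext fun i j => hKA _ _ j.2
  have e2 : (H.charmatrix * K).submatrix (Subtype.val : (Aᶜ : Finset V) → V) Subtype.val =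
      (H.submatrix (Subtype.val : (Aᶜ : Finset V) → V) Subtype.val).charmatrix := by
    rw [← charmatrix_submatrix_val]
    exact Matrix.ext fun i j => hc _ _ (Finset.mem_compl.1 j.2)
  rw [e1, e2] at h1
  rw [mul_comm]
  exact h1.symm

/-- The two cyclic terms of the determinant cancel by skew symmetry, and what remains involves only
the squares of the entries, not the orientation of the arcs. -/
theorem charpoly_fin_three_of_skew {M : Matrix (Fin 3) (Fin 3) ℂ} (hd : ∀ x, M x x = 0)
    (hs : ∀ x y, M y x = - M x y) (hM : ∀ x y, x ≠ y → M x y * M x y = -1) :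
    M.charpoly = X ^ 3 - 3 * X := by
  have h01 : (C (M 0 1) * C (M 0 1) : ℂ[X]) = -1 := by rw [← C_mul, hM _ _ (by decide)]; simp
  have h02 : (C (M 0 2) * C (M 0 2) : ℂ[X]) = -1 := by rw [← C_mul, hM _ _ (by decide)]; simp
  have h12 : (C (M 1 2) * C (M 1 2) : ℂ[X]) = -1 := by rw [← C_mul, hM _ _ (by decide)]; simp
  rw [Matrix.charpoly, Matrix.det_fin_three]
  simp only [Matrix.charmatrix_apply, hd, hs 0 1, hs 0 2, hs 1 2, map_neg]
  simp
  linear_combination (X : ℂ[X]) * h01 + (X : ℂ[X]) * h02 + (X : ℂ[X]) * h12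

theorem charpoly_submatrix_congr_of_skew {H : Matrix V V ℂ} {m : ℂ}
    (hsq : H * H = Matrix.scalar V m) (hd : ∀ x, H x x = 0)
    (hs : ∀ x y, H y x = - H x y) (hH : ∀ x y, x ≠ y → H x y * H x y = -1)
    (hV : 3 ≤ Fintype.card V) {Y Z : Finset V} (hY : Y.card = Fintype.card V - 3)
    (hZ : Z.card = Fintype.card V - 3) :
    (H.submatrix (Subtype.val : Y → V) Subtype.val).charpoly =
      (H.submatrix (Subtype.val : Z → V) Subtype.val).charpoly := by
  have key : ∀ Y : Finset V, Y.card = Fintype.card V - 3 →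
      (H.submatrix (Subtype.val : Y → V) Subtype.val).charpoly * (X ^ 2 - C m) ^ 3 =
        H.charpoly * (X ^ 3 - 3 * X) := by
    intro Y hY
    have hA : (Yᶜ).card = 3 := by rw [Finset.card_compl, hY]; omega
    have h := charpoly_submatrix_compl_mul hsq Yᶜ
    have e : (Yᶜ : Finset V) ≃ Fin 3 := Fintype.equivFinOfCardEq (by rw [Fintype.card_coe, hA])
    rw [hA, ← Matrix.charpoly_reindex e, charpoly_fin_three_of_skew] at h
    · rw [compl_compl] at h
      exact h
    · intro x; simp [hd]
    · intro x y; simp [hs ((e.symm x) : V)]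
    · intro x y hxy
      have := hH (e.symm x) (e.symm y) (fun h => hxy (e.symm.injective (Subtype.ext h)))
      simpa using this
  have hne : (X ^ 2 - C m : ℂ[X]) ^ 3 ≠ 0 :=
    pow_ne_zero _ (monic_X_pow_sub_C m (by norm_num)).ne_zero
  exact mul_right_cancel₀ hne ((key Y hY).trans (key Z hZ).symm)

end ComplementaryMinors

/-! ### Counting in doubly regular tournaments -/

namespace Tournament

section Counting

variable {W : Type u} (T : Tournament W)

open Classical in
/-- The `0`-`1` adjacency of a tournament. -/
noncomputable def ind (x y : W) : ℤ := if T.Dom x y then 1 else 0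

variable {T}

theorem ind_self (x : W) : T.ind x x = 0 := by simp [ind, T.irrefl]

theorem ind_add_ind_of_ne {x y : W} (h : x ≠ y) : T.ind x y + T.ind y x = 1 := by
  rcases T.dom_or_dom h with h | h <;> simp [ind, h, h.not_dom]

theorem ind_congr {V : Type v} {R : Tournament V} {x y : W} {a b : V}
    (h : T.Dom x y ↔ R.Dom a b) : T.ind x y = R.ind a b := by
  by_cases h' : T.Dom x y
  · simp [ind, h', h.1 h']
  · simp [ind, h', mt h.2 h']

theorem two_mul_sum_ind [DecidableEq W] (S : Finset W) :
    2 * ∑ y ∈ S, ∑ z ∈ S, T.ind z y = (S.card : ℤ) * (S.card - 1) := by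
  have h : ∀ y ∈ S, ∑ z ∈ S, (T.ind z y + T.ind y z) = (S.card : ℤ) - 1 := by
    intro y hy
    rw [← Finset.add_sum_erase _ _ hy, ind_self,
      Finset.sum_congr rfl fun z hz => ind_add_ind_of_ne (Finset.ne_of_mem_erase hz)]
    simp [Finset.card_erase_of_mem hy, Nat.cast_sub (Finset.card_pos.2 ⟨y, hy⟩)]
  have h2 := Finset.sum_congr rfl h
  simp only [Finset.sum_add_distrib, Finset.sum_const, nsmul_eq_mul] at h2
  rw [← h2, two_mul]
  congr 1
  exact Finset.sum_comm

variable [Fintype W]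

open Classical in
theorem ncard_common_dominators (x y : W) :
    (({z | T.Dom z x ∧ T.Dom z y} : Set W).ncard : ℤ) = ∑ z, T.ind z x * T.ind z y := by
  have : ({z | T.Dom z x ∧ T.Dom z y} : Set W) =
      ((Finset.univ.filter fun z => T.Dom z x ∧ T.Dom z y : Finset W) : Set W) := by
    ext; simp
  rw [this, Set.ncard_coe_finset, Finset.card_filter]
  push_cast
  refine Finset.sum_congr rfl fun z _ => ?_
  by_cases h1 : T.Dom z x <;> by_cases h2 : T.Dom z y <;> simp [ind, h1, h2]

/-- Count the arcs inside the set `S` of dominators of `x`: each `y ∈ S` is dominated by exactly `t`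
members of `S`, namely the common dominators of `x` and `y`. -/
theorem two_mul_mul_sum_ind_of_common [DecidableEq W] {t : ℤ}
    (h : ∀ x y, x ≠ y → ∑ z, T.ind z x * T.ind z y = t) (x : W) :
    2 * t * ∑ z, T.ind z x = (∑ z, T.ind z x) * (∑ z, T.ind z x - 1) := by
  classical
  let S := Finset.univ.filter fun z => T.Dom z x
  have hS : ∀ f : W → ℤ, ∑ z ∈ S, f z = ∑ z, T.ind z x * f z := by
    intro f
    rw [Finset.sum_filter]
    refine Finset.sum_congr rfl fun z _ => ?_
    by_cases h1 : T.Dom z x <;> simp [ind, h1]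
  have hcard : (S.card : ℤ) = ∑ z, T.ind z x := by
    simpa using hS 1
  have h1 := two_mul_sum_ind (T := T) S
  rw [Finset.sum_congr rfl fun y hy => (hS fun z => T.ind z y).trans
    (h x y (Finset.mem_filter.1 hy).2.ne.symm), Finset.sum_const, nsmul_eq_mul, hcard] at h1
  linarith

theorem ind_nonneg {W : Type u} {T : Tournament W} (x y : W) : 0 ≤ T.ind x y := by
  unfold ind; split_ifs <;> simp

theorem sum_ind_of_common [DecidableEq W] {t : ℤ} (ht : 0 < t)
    (h : ∀ x y, x ≠ y → ∑ z, T.ind z x * T.ind z y = t) (hW : 2 ≤ Fintype.card W) (x : W) :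
    ∑ z, T.ind z x = 2 * t + 1 := by
  have hpos : ∑ z, T.ind z x ≠ 0 := by
    intro h0
    have : Nontrivial W := Fintype.one_lt_card_iff_nontrivial.1 hW
    obtain ⟨y, hy⟩ := exists_ne x
    have h2 := h x y hy.symm
    have h3 := (Finset.sum_eq_zero_iff_of_nonneg fun z _ => ind_nonneg z x).1 h0
    rw [Finset.sum_eq_zero fun z hz => by rw [h3 z hz, zero_mul]] at h2
    omega
  have h4 := two_mul_mul_sum_ind_of_common h x
  rw [mul_comm] at h4
  have := mul_left_cancel₀ hpos h4
  linarith

/-- All in-degrees equal `2t + 1`; compare their sum with the total number of arcs. -/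
theorem card_of_common [DecidableEq W] {t : ℤ} (ht : 0 < t)
    (h : ∀ x y, x ≠ y → ∑ z, T.ind z x * T.ind z y = t) (hW : 2 ≤ Fintype.card W) :
    (Fintype.card W : ℤ) = 4 * t + 3 := by
  have h1 := two_mul_sum_ind (T := T) Finset.univ
  rw [Finset.sum_congr rfl fun x _ => sum_ind_of_common ht h hW x, Finset.sum_const,
    nsmul_eq_mul, Finset.card_univ] at h1
  have h3 : (Fintype.card W : ℤ) ≠ 0 := by
    have : Fintype.card W ≠ 0 := by omega
    exact_mod_cast this
  have h4 : (Fintype.card W : ℤ) * (2 * (2 * t + 1)) = Fintype.card W * (Fintype.card W - 1) := by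
    linarith
  have := mul_left_cancel₀ h3 h4
  linarith

/-- The skew-symmetric `±1` adjacency of a tournament. -/
noncomputable def sgn {W : Type u} (T : Tournament W) (x y : W) : ℤ := T.ind x y - T.ind y x

theorem sgn_mul_self {W : Type u} {T : Tournament W} {x y : W} (h : x ≠ y) :
    T.sgn x y * T.sgn x y = 1 := by
  rcases T.dom_or_dom h with h | h <;> simp [sgn, ind, h, h.not_dom]

theorem sum_sgn [DecidableEq W] (x : W) :
    ∑ z, T.sgn z x = 2 * ∑ z, T.ind z x - (Fintype.card W - 1) := by
  have h : ∀ z, T.sgn z x = 2 * T.ind z x - 1 + if z = x then 1 else 0 := by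
    intro z
    by_cases hz : z = x
    · simp [hz, sgn, ind_self]
    · rw [sgn, if_neg hz, ← ind_add_ind_of_ne hz]; ring
  simp only [h, Finset.sum_add_distrib, Finset.sum_sub_distrib, ← Finset.mul_sum]
  simp
  ring

theorem sum_sgn_mul_sgn [DecidableEq W] {x y : W} (hxy : x ≠ y) :
    ∑ z, T.sgn z x * T.sgn z y = 4 * ∑ z, T.ind z x * T.ind z y - 2 * ∑ z, T.ind z x
      - 2 * ∑ z, T.ind z y + Fintype.card W := by
  -- Expansion of `(2a - 1)(2b - 1)`, corrected at `z = x` and `z = y`. In the sum the two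
  -- corrections cancel, since `ind x y + ind y x = 1`.
  have h : ∀ z, T.sgn z x * T.sgn z y = 4 * (T.ind z x * T.ind z y) - 2 * T.ind z x
      - 2 * T.ind z y + 1 + (if z = x then 2 * T.ind z y - 1 else 0)
      + (if z = y then 2 * T.ind z x - 1 else 0) := by
    intro z
    by_cases hz : z = x
    · subst hz
      have := ind_add_ind_of_ne (T := T) hxy
      simp [hxy, sgn, ind_self]
    · by_cases hz' : z = y
      · subst hz'
        simp [hz, sgn, ind_self]
      · have e1 : T.ind x z = 1 - T.ind z x := by
          linarith [ind_add_ind_of_ne (T := T) hz]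
        have e2 : T.ind y z = 1 - T.ind z y := by
          linarith [ind_add_ind_of_ne (T := T) hz']
        rw [sgn, sgn, if_neg hz, if_neg hz', e1, e2]
        ring
  simp only [h, Finset.sum_add_distrib, Finset.sum_sub_distrib, ← Finset.mul_sum]
  have := ind_add_ind_of_ne (T := T) hxy
  simp
  linarith

end Counting

/-! ### The added vertex and orthogonality of the sign matrix -/

section Hat

variable {W : Type u} {T : Tournament W}

theorem hat_sgn_none_some (x : W) : T.hat.sgn none (some x) = 1 := by
  simp [sgn, ind, hat]

theorem hat_sgn_some_none (x : W) : T.hat.sgn (some x) none = -1 := by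
  simp [sgn, ind, hat]

theorem hat_sgn_some_some (x y : W) : T.hat.sgn (some x) (some y) = T.sgn x y :=
  congrArg₂ (· - ·) (ind_congr Iff.rfl) (ind_congr Iff.rfl)

theorem sgn_self (x : W) : T.sgn x x = 0 := by simp [sgn]

theorem sgn_swap (x y : W) : T.sgn y x = - T.sgn x y := by simp [sgn]

/-- With in-degrees `2t + 1` and order `4t + 3`, sign columns of `T` sum to `0` and two distinct
ones have inner product `-1`. The new row adds `1` to the latter. -/
theorem IsDoublyRegular.sum_hat_sgn_mul_sgn [Fintype W] [DecidableEq W] (hT : T.IsDoublyRegular)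
    (hW : 2 ≤ Fintype.card W) {x y : Option W} (hxy : x ≠ y) :
    ∑ z, T.hat.sgn z x * T.hat.sgn z y = 0 := by
  obtain ⟨t, ht, h⟩ := hT
  have h' : ∀ x y, x ≠ y → ∑ z, T.ind z x * T.ind z y = t := by
    intro x y hxy
    rw [← ncard_common_dominators, h x y hxy]
  have ht' : (0 : ℤ) < t := by exact_mod_cast ht
  have hc := card_of_common ht' h' hW
  have hi := sum_ind_of_common ht' h' hW
  rw [Fintype.sum_option]
  rcases x with _ | x <;> rcases y with _ | y
  · exact absurd rfl hxy
  · simp only [sgn_self, hat_sgn_some_none, hat_sgn_some_some, neg_mul, one_mul,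
      Finset.sum_neg_distrib, sum_sgn, hi, hc]
    ring
  · simp only [sgn_self, hat_sgn_some_none, hat_sgn_some_some, mul_neg, mul_one,
      Finset.sum_neg_distrib, sum_sgn, hi, hc]
    ring
  · have hxy' : x ≠ y := fun e => hxy (congrArg some e)
    simp only [hat_sgn_none_some, hat_sgn_some_some, sum_sgn_mul_sgn hxy', hi, hc, h' x y hxy']
    ring

theorem Isomorphic.sgn_eq {V : Type v} {R : Tournament V} {σ : V ≃ W}
    (h : ∀ x y, R.Dom x y ↔ T.Dom (σ x) (σ y)) (x y : V) :
    R.sgn x y = T.sgn (σ x) (σ y) :=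
  congrArg₂ (· - ·) (ind_congr (h x y)) (ind_congr (h y x))

end Hat

theorem adjMatrix_rep_I {V : Type u} [DecidableEq V] (R : Tournament V) (x y : V) :
    (R.rep Complex.I).adjMatrix x y = Complex.I * R.sgn x y := by
  by_cases h : x = y
  · subst h; simp [L2Structure.adjMatrix_self, sgn_self]
  · rcases R.dom_or_dom h with h | h
    · simp [h.adjMatrix_rep, sgn, ind, h, h.not_dom]
    · simp [h.adjMatrix_rep_symm, sgn, ind, h, h.not_dom]

theorem IsDoublyRegular.rep_spectrallyMonomorphic {V : Type u} {W : Type v} [Fintype V]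
    [DecidableEq V] [Fintype W] {T : Tournament W} {R : Tournament V} (hT : T.IsDoublyRegular)
    (hR : R.Isomorphic T.hat) (hW : 2 ≤ Fintype.card W) :
    (R.rep Complex.I).SpectrallyMonomorphic (Fintype.card V - 3) := by
  classical
  obtain ⟨σ, hσ⟩ := hR
  have hVW : Fintype.card V = Fintype.card W + 1 := by
    rw [Fintype.card_congr σ, Fintype.card_option]
  have horth : ∀ x y : V, x ≠ y → ∑ z, R.sgn z x * R.sgn z y = 0 := by
    intro x y hxy
    rw [← hT.sum_hat_sgn_mul_sgn hW (σ.injective.ne hxy), ← Equiv.sum_comp σ]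
    simp only [Isomorphic.sgn_eq hσ]
  -- The matrix is `i` times the skew sign matrix, so its square is the Gram matrix of the sign
  -- columns.
  have hsq : (R.rep Complex.I).adjMatrix * (R.rep Complex.I).adjMatrix =
      Matrix.scalar V ((Fintype.card V : ℂ) - 1) := by
    ext x y
    have e : ∀ z, (R.rep Complex.I).adjMatrix x z * (R.rep Complex.I).adjMatrix z y =
        ((R.sgn z x * R.sgn z y : ℤ) : ℂ) := by
      intro z
      rw [adjMatrix_rep_I, adjMatrix_rep_I, sgn_swap z x]
      push_cast
      linear_combination (-(R.sgn z x : ℂ) * R.sgn z y) * Complex.I_mul_I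
    rw [Matrix.mul_apply, Finset.sum_congr rfl fun z _ => e z, ← Int.cast_sum]
    by_cases hxy : x = y
    · subst hxy
      rw [← Finset.add_sum_erase _ _ (Finset.mem_univ x), sgn_self,
        Finset.sum_congr rfl fun z hz => sgn_mul_self (Finset.ne_of_mem_erase hz)]
      simp [Finset.card_erase_of_mem, Nat.cast_sub (Fintype.card_pos_iff.2 ⟨x⟩)]
    · rw [horth x y hxy]
      simp [hxy]
  intro Y Z hY hZ
  rw [L2Structure.charPoly_induce, L2Structure.charPoly_induce]
  refine charpoly_submatrix_congr_of_skew hsq (L2Structure.adjMatrix_self _) ?_ ?_ (by omega) hY hZ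
  · intro x y
    rw [adjMatrix_rep_I, adjMatrix_rep_I, sgn_swap x y]
    push_cast
    ring
  · intro x y hxy
    have h1 : ((R.sgn x y : ℂ)) * R.sgn x y = 1 := by exact_mod_cast sgn_mul_self hxy
    rw [adjMatrix_rep_I]
    linear_combination (R.sgn x y : ℂ) * R.sgn x y * Complex.I_mul_I - h1

end Tournament

theorem L2Structure.InList.spectrallyMonomorphic {V : Type u} [Fintype V] [DecidableEq V]
    {g : L2Structure V ℂ} (hV : 3 ≤ Fintype.card V) (h : g.InList) :
    g.SpectrallyMonomorphic (Fintype.card V - 3) := by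
  rcases h with ⟨r, h⟩ | ⟨c, T, -, -, hT, h⟩ | ⟨T, R, hT, hR, h⟩
  · exact (h.spectrallyMonomorphic_iff _).1 (realConst_spectrallyMonomorphic r _)
  · exact (h.spectrallyMonomorphic_iff _).1 (hT.rep_spectrallyMonomorphic c _)
  · exact (h.spectrallyMonomorphic_iff _).1
      (hT.rep_spectrallyMonomorphic hR (by rw [Fintype.card_fin]; omega))

/-! ### From equal `3`-cycle counts on arcs to double regularity -/

namespace Tournament

/-- A tournament whose arcs all lie in the same positive number of `3`-cycles is doubly
regular. -/
theorem isDoublyRegular_of_homogeneous {W : Type u} [Fintype W] [DecidableEq W]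
    {T : Tournament W} {d : ℤ} (hW : 5 ≤ Fintype.card W) (hd0 : d ≠ 0)
    (hd : ∀ x y, T.Dom x y → ∑ w, T.ind y w * T.ind w x = d) : T.IsDoublyRegular := by
  have hsum : ∀ x, ∑ w, T.ind w x + ∑ w, T.ind x w = (Fintype.card W : ℤ) - 1 := by
    intro x
    rw [← Finset.sum_add_distrib, ← Finset.add_sum_erase _ _ (Finset.mem_univ x), ind_self,
      Finset.sum_congr rfl fun z hz => ind_add_ind_of_ne (Finset.ne_of_mem_erase hz)]
    simp [Finset.card_erase_of_mem, Nat.cast_sub (Fintype.card_pos_iff.2 ⟨x⟩)]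
  have hmul : ∀ x y, T.ind x y * ∑ w, T.ind y w * T.ind w x = T.ind x y * d := by
    intro x y
    by_cases h : T.Dom x y
    · rw [hd x y h]
    · simp [ind, h]
  -- The `3`-cycles through `x` number `d` times its in-degree and also `d` times its out-degree.
  have hreg : ∀ x, ∑ w, T.ind w x = ∑ w, T.ind x w := by
    intro x
    refine mul_right_cancel₀ hd0 ?_
    rw [Finset.sum_mul, Finset.sum_mul, ← Finset.sum_congr rfl fun w _ => hmul w x,
      ← Finset.sum_congr rfl fun w _ => hmul x w]
    simp only [Finset.mul_sum]
    rw [Finset.sum_comm]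
    refine Finset.sum_congr rfl fun y _ => Finset.sum_congr rfl fun w _ => ?_
    ring
  have hin : ∀ x, 2 * ∑ w, T.ind w x = (Fintype.card W : ℤ) - 1 := by
    intro x
    rw [← hsum x, ← hreg x, two_mul]
  obtain ⟨v⟩ : Nonempty W := Fintype.card_pos_iff.1 (by omega)
  -- For an arc from `x` to `y`, each dominator of `x` either dominates `y` too or closes a
  -- `3`-cycle on the arc.
  have harc : ∀ x y, T.Dom x y →
      ∑ z, T.ind z x * T.ind z y = ∑ w, T.ind w v - d := by
    intro x y h
    have e : ∑ w, T.ind w v = ∑ w, T.ind w x := by linarith [hin x, hin v]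
    rw [e, ← hd x y h, ← Finset.sum_sub_distrib]
    refine Finset.sum_congr rfl fun z _ => ?_
    by_cases hz : z = y
    · subst hz
      simp [ind, h.not_dom]
    · have : T.ind z y = 1 - T.ind y z := by
        linarith [ind_add_ind_of_ne (T := T) hz]
      rw [this]
      ring
  have hcommon : ∀ x y, x ≠ y → ∑ z, T.ind z x * T.ind z y = ∑ w, T.ind w v - d := by
    intro x y h
    rcases T.dom_or_dom h with h | h
    · exact harc x y h
    · simpa only [mul_comm] using harc y x h
  -- Twice the common count is the in-degree minus `1`, and the in-degree is at least `2` because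
  -- the order is at least `5`.
  have hpos : 0 < ∑ w, T.ind w v - d := by
    have h1 := two_mul_mul_sum_ind_of_common hcommon v
    have h2 := hin v
    have h3 : ∑ w, T.ind w v ≠ 0 := by omega
    rw [mul_comm] at h1
    have := mul_left_cancel₀ h3 h1
    omega
  refine ⟨(∑ w, T.ind w v - d).toNat, by omega, fun x y hxy => ?_⟩
  have := ncard_common_dominators (T := T) x y
  rw [hcommon x y hxy] at this
  omega

end Tournament

/-! ### Constancy of minors of order 2, 3 and 4 -/

namespace L2Structure

section Forward

variable {V : Type u} [DecidableEq V]

theorem card_triple {x y z : V} (hxy : x ≠ y) (hxz : x ≠ z) (hyz : y ≠ z) :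
    ({x, y, z} : Finset V).card = 3 :=
  Finset.card_eq_three.2 ⟨x, y, z, hxy, hxz, hyz, rfl⟩

variable [Fintype V]

theorem SpectrallyMonomorphic.subsetSumConst {g : L2Structure V ℂ} {k : ℕ}
    (h : g.SpectrallyMonomorphic k) (hk : k ≤ Fintype.card V) {p : ℕ} (hp : p ≤ k) :
    SubsetSumConst (principalMinor g.adjMatrix) p k := by
  obtain ⟨X, -, hX⟩ := Finset.exists_subset_card_eq (s := (Finset.univ : Finset V)) hk
  exact ⟨_, fun Y hY => (spectrallyMonomorphic_iff g k).1 h Y X hY hX p hp⟩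

theorem SpectrallyMonomorphic.pair_triple {g : L2Structure V ℂ}
    (h : g.SpectrallyMonomorphic (Fintype.card V - 3)) (hV : 3 ≤ Fintype.card V) {p : ℕ}
    (hp : p ≤ Fintype.card V - 3) :
    (∃ K : ℂ, ∀ x y : V, x ≠ y → ∑ P ∈ (Finset.univ.powersetCard p).filter
      (fun P => x ∈ P ∧ y ∈ P), principalMinor g.adjMatrix P = K) ∧
    ∃ K : ℂ, ∀ x y z : V, x ≠ y → x ≠ z → y ≠ z → ∑ P ∈ (Finset.univ.powersetCard p).filter
      (fun P => x ∈ P ∧ y ∈ P ∧ z ∈ P), principalMinor g.adjMatrix P = K := by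
  -- Constancy climbs from `(n - 3)`-sets to `n`-sets, giving the four levels that
  -- inclusion–exclusion on triples uses.
  have h3 := h.subsetSumConst (by omega) hp
  have h2 := h3.succ hp
  have h1 := h2.succ (by omega)
  have h0 := h1.succ (by omega)
  rw [show Fintype.card V - 3 + 1 = Fintype.card V - 2 by omega] at h2 h1 h0
  rw [show Fintype.card V - 2 + 1 = Fintype.card V - 1 by omega] at h1 h0
  rw [show Fintype.card V - 1 + 1 = Fintype.card V by omega] at h0
  exact ⟨h0.contains_pair h1 h2, h0.contains_triple h1 h2 h3⟩

theorem SpectrallyMonomorphic.minor_pair {g : L2Structure V ℂ}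
    (h : g.SpectrallyMonomorphic (Fintype.card V - 3)) (hV : 6 ≤ Fintype.card V) :
    ∃ K : ℂ, ∀ x y : V, x ≠ y → principalMinor g.adjMatrix {x, y} = K := by
  obtain ⟨K, hK⟩ := (h.pair_triple (by omega) (p := 2) (by omega)).1
  refine ⟨K, fun x y hxy => ?_⟩
  rw [← hK x y hxy, ← Finset.sum_singleton (principalMinor g.adjMatrix) {x, y}]
  congr 1
  ext P
  simp only [Finset.mem_singleton, Finset.mem_filter, Finset.mem_powersetCard_univ]
  constructor
  · rintro rfl
    exact ⟨Finset.card_pair hxy, by simp, by simp⟩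
  · rintro ⟨hc, hx, hy⟩
    refine (Finset.eq_of_subset_of_card_le ?_ ?_).symm
    · simp [Finset.insert_subset_iff, hx, hy]
    · rw [hc, Finset.card_pair hxy]

theorem SpectrallyMonomorphic.minor_triple {g : L2Structure V ℂ}
    (h : g.SpectrallyMonomorphic (Fintype.card V - 3)) (hV : 6 ≤ Fintype.card V) :
    ∃ K : ℂ, ∀ x y z : V, x ≠ y → x ≠ z → y ≠ z →
      principalMinor g.adjMatrix {x, y, z} = K := by
  obtain ⟨K, hK⟩ := (h.pair_triple (by omega) (p := 3) (by omega)).2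
  refine ⟨K, fun x y z hxy hxz hyz => ?_⟩
  rw [← hK x y z hxy hxz hyz, ← Finset.sum_singleton (principalMinor g.adjMatrix) {x, y, z}]
  congr 1
  ext P
  simp only [Finset.mem_singleton, Finset.mem_filter, Finset.mem_powersetCard_univ]
  constructor
  · rintro rfl
    exact ⟨card_triple hxy hxz hyz, by simp, by simp, by simp⟩
  · rintro ⟨hc, hx, hy, hz⟩
    refine (Finset.eq_of_subset_of_card_le ?_ ?_).symm
    · simp [Finset.insert_subset_iff, hx, hy, hz]
    · rw [hc, card_triple hxy hxz hyz]

theorem SpectrallyMonomorphic.sum_minor_quadruple {g : L2Structure V ℂ}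
    (h : g.SpectrallyMonomorphic (Fintype.card V - 3)) (hV : 7 ≤ Fintype.card V) :
    ∃ K : ℂ, ∀ x y z : V, x ≠ y → x ≠ z → y ≠ z →
      ∑ w ∈ ({x, y, z} : Finset V)ᶜ, principalMinor g.adjMatrix {w, x, y, z} = K := by
  obtain ⟨K, hK⟩ := (h.pair_triple (by omega) (p := 4) (by omega)).2
  refine ⟨K, fun x y z hxy hxz hyz => ?_⟩
  rw [← hK x y z hxy hxz hyz]
  refine Finset.sum_bij (fun w _ => {w, x, y, z}) ?_ ?_ ?_ ?_
  · intro w hw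
    simp only [Finset.mem_filter, Finset.mem_powersetCard_univ]
    refine ⟨?_, by simp, by simp, by simp⟩
    rw [Finset.card_insert_of_notMem (Finset.mem_compl.1 hw), card_triple hxy hxz hyz]
  · intro a ha b _ hab
    have : a ∈ insert b ({x, y, z} : Finset V) := hab ▸ Finset.mem_insert_self a _
    exact (Finset.mem_insert.1 this).resolve_right (Finset.mem_compl.1 ha)
  · intro P hP
    simp only [Finset.mem_filter, Finset.mem_powersetCard_univ] at hP
    obtain ⟨hc, hx, hy, hz⟩ := hP
    have hsub : ({x, y, z} : Finset V) ⊆ P := by simp [Finset.insert_subset_iff, hx, hy, hz]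
    have h1 : (P \ {x, y, z}).card = 1 := by
      rw [Finset.card_sdiff_of_subset hsub, hc, card_triple hxy hxz hyz]
    obtain ⟨w, hw⟩ := Finset.card_eq_one.1 h1
    have hw' : w ∈ P \ {x, y, z} := hw ▸ Finset.mem_singleton_self w
    refine ⟨w, Finset.mem_compl.2 (Finset.mem_sdiff.1 hw').2, ?_⟩
    rw [Finset.insert_eq, ← hw, Finset.sdiff_union_of_subset hsub]
  · intro w _
    rfl

end Forward

end L2Structure

/-! ### Normalization along the row of a vertex -/

namespace L2Structure

section Forward

variable {V : Type u}

theorem IsHermitian.scale {g : L2Structure V ℂ} (hg : g.IsHermitian) (δ : V → ℂ) :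
    (g.scale δ).IsHermitian := by
  intro x y h
  simp only [L2Structure.scale, map_mul, Complex.conj_conj]
  rw [hg x y h]
  ring

variable [DecidableEq V]

theorem IsHermitian.adjMatrix_symm {g : L2Structure V ℂ} (hg : g.IsHermitian) (x y : V) :
    g.adjMatrix y x = conj (g.adjMatrix x y) := by
  by_cases h : x = y
  · subst h; simp [adjMatrix_self]
  · rw [adjMatrix_of_ne _ h, adjMatrix_of_ne _ (Ne.symm h)]
    exact hg _ _ _

theorem IsHermitian.minor_pair {g : L2Structure V ℂ} (hg : g.IsHermitian) {x y : V} (h : x ≠ y) :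
    principalMinor g.adjMatrix {x, y} = -(Complex.normSq (g.adjMatrix x y) : ℂ) := by
  rw [principalMinor_pair _ h, adjMatrix_self, hg.adjMatrix_symm x y, Complex.mul_conj]
  ring

theorem IsHermitian.minor_triple {g : L2Structure V ℂ} (hg : g.IsHermitian) {x y z : V}
    (hxy : x ≠ y) (hxz : x ≠ z) (hyz : y ≠ z) :
    principalMinor g.adjMatrix {x, y, z} =
      ((2 * (g.adjMatrix x y * g.adjMatrix y z * g.adjMatrix z x).re : ℝ) : ℂ) := by
  rw [principalMinor_triple _ hxy hxz hyz, ← Complex.add_conj]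
  simp only [adjMatrix_self, map_mul, ← hg.adjMatrix_symm]
  ring

theorem eq_realConst {g : L2Structure V ℂ} {r : ℝ}
    (h : ∀ x y, x ≠ y → g.adjMatrix x y = r) : g = realConst V r := by
  funext x y hxy
  rw [← adjMatrix_of_ne g hxy, h x y hxy, realConst]

theorem exists_eq_rep {g : L2Structure V ℂ} (hg : g.IsHermitian) {c : ℂ} (hc : c.im ≠ 0)
    (h : ∀ x y, x ≠ y → g.adjMatrix x y = c ∨ g.adjMatrix x y = conj c) :
    ∃ R : Tournament V, g = R.rep c ∧ ∀ x y, x ≠ y → (R.Dom x y ↔ g.adjMatrix x y = c) := by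
  have hcc : conj c ≠ c := fun e => hc (Complex.conj_eq_iff_im.1 e)
  let R : Tournament V :=
    { Dom := fun x y => x ≠ y ∧ g.adjMatrix x y = c
      irrefl := fun x hx => hx.1 rfl
      dom_iff := by
        intro x y hxy
        rw [hg.adjMatrix_symm x y]
        rcases h x y hxy with e | e
        · simp [e, hxy, hcc]
        · simp [e, hxy, hxy.symm, hcc] }
  have hR : ∀ x y, x ≠ y → (R.Dom x y ↔ g.adjMatrix x y = c) := fun x y hxy =>
    ⟨fun h => h.2, fun h => ⟨hxy, h⟩⟩
  refine ⟨R, ext_adjMatrix (Matrix.ext fun x y => ?_), hR⟩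
  by_cases hxy : x = y
  · subst hxy; simp [adjMatrix_self]
  · by_cases hD : R.Dom x y
    · rw [hD.adjMatrix_rep, (hR x y hxy).1 hD]
    · rw [((R.dom_or_dom hxy).resolve_left hD).adjMatrix_rep_symm]
      exact (h x y hxy).resolve_left fun e => hD ((hR x y hxy).2 e)

/-- After division by `s ^ 6` the triangle products at `v` lie on the unit circle with a common real
part, so they take only two conjugate values. Rescaling by the row of `v` turns the entries away
from `v` into these products. -/
theorem exists_normalized {g : L2Structure V ℂ} (hg : g.IsHermitian) {s : ℝ} (hs : 0 < s)
    (hns : ∀ x y, x ≠ y → Complex.normSq (g.adjMatrix x y) = s ^ 4) (v : V) {t : ℝ}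
    (ht : ∀ y z, v ≠ y → v ≠ z → y ≠ z →
      (g.adjMatrix v y * g.adjMatrix y z * g.adjMatrix z v).re = t)
    (hex : ∃ y z, v ≠ y ∧ v ≠ z ∧ y ≠ z) :
    ∃ (c : ℂ) (δ : V → ℂ), ‖c‖ = 1 ∧ 0 ≤ c.im ∧ IsSelector δ ∧
      (∀ y, v ≠ y → (g.scale δ).adjMatrix v y = c) ∧
      ∀ x y, x ≠ y → (g.scale δ).adjMatrix x y = c ∨ (g.scale δ).adjMatrix x y = conj c := by
  have hsC : (s : ℂ) ≠ 0 := by exact_mod_cast hs.ne'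
  have hmc : ∀ x y, x ≠ y → g.adjMatrix x y * conj (g.adjMatrix x y) = (s : ℂ) ^ 4 := by
    intro x y h
    rw [Complex.mul_conj, hns x y h]
    push_cast
    rfl
  have hnorm : ∀ x y, x ≠ y → ‖g.adjMatrix x y‖ = s ^ 2 := by
    intro x y h
    have := hns x y h
    rw [Complex.normSq_eq_norm_sq] at this
    exact (pow_left_inj₀ (norm_nonneg _) (by positivity) two_ne_zero).1 (by rw [this]; ring)
  let τ : V → V → ℂ := fun y z =>
    g.adjMatrix v y * g.adjMatrix y z * g.adjMatrix z v / ((s ^ 6 : ℝ) : ℂ)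
  have hτre : ∀ y z, v ≠ y → v ≠ z → y ≠ z → (τ y z).re = t / s ^ 6 := by
    intro y z h1 h2 h3
    rw [Complex.div_ofReal_re, ht y z h1 h2 h3]
  have hτn : ∀ y z, v ≠ y → v ≠ z → y ≠ z → (τ y z).re ^ 2 + (τ y z).im ^ 2 = 1 := by
    intro y z h1 h2 h3
    have : Complex.normSq (τ y z) = 1 := by
      rw [Complex.normSq_div, map_mul, map_mul, hns v y h1, hns y z h3, hns z v h2.symm,
        Complex.normSq_ofReal]
      field_simp
    rw [Complex.normSq_apply] at this
    linarith
  obtain ⟨a, ha⟩ : ∃ a, a = t / s ^ 6 := ⟨_, rfl⟩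
  have ha1 : 0 ≤ 1 - a ^ 2 := by
    obtain ⟨y, z, h1, h2, h3⟩ := hex
    have := hτn y z h1 h2 h3
    rw [hτre y z h1 h2 h3, ← ha] at this
    nlinarith [sq_nonneg (τ y z).im]
  obtain ⟨c, hcre, hcim⟩ : ∃ c : ℂ, c.re = a ∧ c.im = √(1 - a ^ 2) := ⟨⟨a, _⟩, rfl, rfl⟩
  have hcsq : c.im ^ 2 = 1 - a ^ 2 := by rw [hcim, Real.sq_sqrt ha1]
  have hcn : ‖c‖ = 1 := by
    rw [← pow_left_inj₀ (norm_nonneg _) zero_le_one two_ne_zero, ← Complex.normSq_eq_norm_sq,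
      Complex.normSq_apply, hcre]
    linarith
  have hτc : ∀ y z, v ≠ y → v ≠ z → y ≠ z → τ y z = c ∨ τ y z = conj c := by
    intro y z h1 h2 h3
    have e1 := hτre y z h1 h2 h3
    have e2 := hτn y z h1 h2 h3
    rw [e1, ← ha] at e2
    have e3 : (τ y z).im ^ 2 = c.im ^ 2 := by linarith
    refine (sq_eq_sq_iff_eq_or_eq_neg.1 e3).imp (fun h => ?_) (fun h => ?_)
    · exact Complex.ext (by rw [e1, ← ha, hcre]) h
    · exact Complex.ext (by rw [e1, ← ha, Complex.conj_re, hcre]) (by rw [h, Complex.conj_im])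
  -- All labels have modulus `s ^ 2`, so these powers of `s` give `δ` constant modulus `1 / s`; the
  -- factor `c` at `v` makes row `v` equal to `c`.
  let δ : V → ℂ := fun x => if x = v then c / s else g.adjMatrix v x / (s : ℂ) ^ 3
  have hδv : δ v = c / s := if_pos rfl
  have hδ : ∀ x, v ≠ x → δ x = g.adjMatrix v x / (s : ℂ) ^ 3 := fun x h => if_neg h.symm
  have hδn : ∀ x, ‖δ x‖ = 1 / s := by
    intro x
    by_cases h : v = x
    · subst h
      rw [hδv, norm_div, hcn, Complex.norm_real, Real.norm_of_nonneg hs.le]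
    · rw [hδ x h, norm_div, hnorm v x h, norm_pow, Complex.norm_real, Real.norm_of_nonneg hs.le]
      field_simp
  have hv : ∀ y, v ≠ y → (g.scale δ).adjMatrix v y = c := by
    intro y h
    rw [adjMatrix_scale, hδv, hδ y h, map_div₀, map_pow, Complex.conj_ofReal, mul_div_assoc',
      hmc v y h]
    field_simp
  refine ⟨c, δ, hcn, by rw [hcim]; positivity, ⟨fun x hx => ?_, fun x y => by rw [hδn, hδn]⟩, hv,
    fun x y hxy => ?_⟩
  · have := hδn x
    rw [hx, norm_zero] at this
    have : 0 < 1 / s := by positivity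
    linarith
  · by_cases hx : v = x
    · subst hx
      exact Or.inl (hv y hxy)
    · by_cases hy : v = y
      · subst hy
        right
        rw [(hg.scale δ).adjMatrix_symm v x, hv x hx]
      · have e : (g.scale δ).adjMatrix x y = τ x y := by
          rw [adjMatrix_scale, hδ x hx, hδ y hy, map_div₀, map_pow, Complex.conj_ofReal,
            ← hg.adjMatrix_symm]
          simp only [τ]
          push_cast
          field_simp
        rw [e]
        exact hτc x y hx hy hxy

variable [Fintype V]

theorem SpectrallyMonomorphic.exists_rep {g : L2Structure V ℂ} (hg : g.IsHermitian)
    (h : g.SpectrallyMonomorphic (Fintype.card V - 3)) (hV : 6 ≤ Fintype.card V) (v : V) :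
    (∃ r : ℝ, g.Equivalent (realConst V r)) ∨
      ∃ (c : ℂ) (R : Tournament V), ‖c‖ = 1 ∧ 0 < c.im ∧ (∀ y, v ≠ y → R.Dom v y) ∧
        g.Equivalent (R.rep c) := by
  have hex : ∃ y z, v ≠ y ∧ v ≠ z ∧ y ≠ z := by
    obtain ⟨y, hy, z, hz, hyz⟩ := Finset.one_lt_card.1
      (show 1 < (Finset.univ.erase v).card by
        rw [Finset.card_erase_of_mem (Finset.mem_univ _), Finset.card_univ]; omega)
    exact ⟨y, z, (Finset.ne_of_mem_erase hy).symm, (Finset.ne_of_mem_erase hz).symm, hyz⟩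
  obtain ⟨y₁, z₁, hy₁, hz₁, hyz₁⟩ := hex
  obtain ⟨K, hK⟩ := h.minor_pair hV
  obtain ⟨K', hK'⟩ := h.minor_triple hV
  have hns : ∀ x y, x ≠ y →
      Complex.normSq (g.adjMatrix x y) = Complex.normSq (g.adjMatrix v y₁) := by
    intro x y hxy
    have := (hK x y hxy).trans (hK v y₁ hy₁).symm
    rw [hg.minor_pair hxy, hg.minor_pair hy₁, neg_inj] at this
    exact_mod_cast this
  have htr : ∀ y z, v ≠ y → v ≠ z → y ≠ z →
      (g.adjMatrix v y * g.adjMatrix y z * g.adjMatrix z v).re =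
        (g.adjMatrix v y₁ * g.adjMatrix y₁ z₁ * g.adjMatrix z₁ v).re := by
    intro y z h1 h2 h3
    have := (hK' v y z h1 h2 h3).trans (hK' v y₁ z₁ hy₁ hz₁ hyz₁).symm
    rw [hg.minor_triple h1 h2 h3, hg.minor_triple hy₁ hz₁ hyz₁, Complex.ofReal_inj] at this
    linarith
  rcases (Complex.normSq_nonneg (g.adjMatrix v y₁)).eq_or_lt with h0 | h0
  · left
    refine ⟨0, fun _ => 1, ⟨fun _ => one_ne_zero, fun _ _ => rfl⟩, (eq_realConst ?_).symm⟩
    intro x y hxy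
    rw [adjMatrix_scale, Complex.normSq_eq_zero.1 ((hns x y hxy).trans h0.symm)]
    simp
  · obtain ⟨s, hs, hs4⟩ : ∃ s : ℝ, 0 < s ∧ s ^ 4 = Complex.normSq (g.adjMatrix v y₁) := by
      refine ⟨√√(Complex.normSq (g.adjMatrix v y₁)), by positivity, ?_⟩
      rw [show (4 : ℕ) = 2 * 2 from rfl, pow_mul, Real.sq_sqrt (by positivity),
        Real.sq_sqrt h0.le]
    obtain ⟨c, δ, hcn, hc0, hδ, hv, hc⟩ := exists_normalized hg hs
      (fun x y hxy => (hns x y hxy).trans hs4.symm) v htr ⟨y₁, z₁, hy₁, hz₁, hyz₁⟩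
    rcases hc0.eq_or_lt with h1 | h1
    · left
      have hcr : conj c = c := Complex.conj_eq_iff_im.2 h1.symm
      refine ⟨c.re, δ, hδ, (eq_realConst fun x y hxy => ?_).symm⟩
      rw [Complex.conj_eq_iff_re.1 hcr]
      have := hc x y hxy
      rwa [hcr, or_self] at this
    · right
      obtain ⟨R, hR, hRD⟩ := exists_eq_rep (hg.scale δ) h1.ne' hc
      exact ⟨c, R, hcn, h1, fun y hy => (hRD v y hy).2 (hv y hy), δ, hδ, hR.symm⟩

end Forward

end L2Structure

/-! ### The non-transitive case -/

namespace Tournament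

section Forward

variable {V : Type u} [DecidableEq V] [Fintype V]

theorem rep_isHermitian {V : Type u} (R : Tournament V) (c : ℂ) : (R.rep c).IsHermitian := by
  intro x y h
  rcases R.dom_or_dom h with h | h <;> simp [rep, h, h.not_dom]

theorem exists_cyclic_of_not_isTransitive {V : Type u} {R : Tournament V}
    (h : ¬ R.IsTransitive) : ∃ x y z, R.Dom x y ∧ R.Dom y z ∧ R.Dom z x := by
  unfold IsTransitive at h
  push Not at h
  obtain ⟨x, y, z, hxy, hyz, hxz⟩ := h
  refine ⟨x, y, z, hxy, hyz, (R.dom_or_dom ?_).resolve_left hxz⟩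
  rintro rfl
  exact hxy.not_dom hyz

/-- The `3`-cycle contributes `Re(c³)` and the triple `v, x, y` contributes `Re(c · c · conj c)`.
Their difference is `-4 Re(c) Im(c)²`, so `Re(c) = 0`. -/
theorem eq_I_of_cyclic {R : Tournament V} {c : ℂ} {v : V} (hc : ‖c‖ = 1) (hc0 : 0 < c.im)
    (hv : ∀ y, v ≠ y → R.Dom v y) (hV : 6 ≤ Fintype.card V)
    (h : (R.rep c).SpectrallyMonomorphic (Fintype.card V - 3)) {x y z : V} (hxy : R.Dom x y)
    (hyz : R.Dom y z) (hzx : R.Dom z x) : c = Complex.I := by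
  have hne : ∀ {a b}, R.Dom a b → v ≠ b := by
    rintro a b hab rfl
    exact hab.not_dom (hv a hab.ne.symm)
  obtain ⟨K, hK⟩ := h.minor_triple hV
  have e := (hK x y z hxy.ne hzx.ne.symm hyz.ne).trans
    (hK v x y (hne hzx) (hne hxy) hxy.ne).symm
  have hH := R.rep_isHermitian c
  rw [hH.minor_triple hxy.ne hzx.ne.symm hyz.ne, hH.minor_triple (hne hzx) (hne hxy) hxy.ne,
    Complex.ofReal_inj, hxy.adjMatrix_rep, hyz.adjMatrix_rep, hzx.adjMatrix_rep,
    (hv x (hne hzx)).adjMatrix_rep, (hv y (hne hxy)).adjMatrix_rep_symm] at e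
  have hn : c.re * c.re + c.im * c.im = 1 := by
    rw [← Complex.normSq_apply, Complex.normSq_eq_norm_sq, hc, one_pow]
  simp only [Complex.mul_re, Complex.mul_im, Complex.conj_re, Complex.conj_im] at e
  have hre : c.re = 0 := by
    have : c.re * (c.im * c.im) = 0 := by
      linear_combination (-1 / 8 : ℝ) * e
    simpa [hc0.ne'] using this
  refine Complex.ext (by simpa using hre) ?_
  rw [hre] at hn
  rw [Complex.I_im]
  nlinarith

theorem exists_sum_cyclic {R : Tournament V} {v : V} (hv : ∀ y, v ≠ y → R.Dom v y)
    (hV : 7 ≤ Fintype.card V)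
    (h : (R.rep Complex.I).SpectrallyMonomorphic (Fintype.card V - 3)) :
    ∃ d : ℤ, ∀ x y, v ≠ x → R.Dom x y → ∑ w, R.ind y w * R.ind w x = d := by
  have hne : ∀ {a b}, R.Dom a b → v ≠ b := by
    rintro a b hab rfl
    exact hab.not_dom (hv a hab.ne.symm)
  have hind0 : ∀ w, R.ind w v = 0 := fun w => if_neg fun h => hne h rfl
  obtain ⟨K, hK⟩ := h.sum_minor_quadruple hV
  have key : ∀ x y, v ≠ x → R.Dom x y →
      (((Fintype.card V - 3 : ℕ) + 8 * ∑ w, R.ind y w * R.ind w x : ℤ) : ℂ) = K := by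
    intro x y hx hxy
    have hy := hne hxy
    rw [← hK v x y hx hy hxy.ne]
    -- The Pfaffian is a sum of three signs, equal to `3` when `w` closes a `3`-cycle on the arc
    -- from `x` to `y` and to `±1` otherwise; its square is `9` or `1`.
    have e : ∀ w ∈ ({v, x, y} : Finset V)ᶜ,
        principalMinor (R.rep Complex.I).adjMatrix {w, v, x, y} =
          ((1 + 8 * (R.ind y w * R.ind w x) : ℤ) : ℂ) := by
      intro w hw
      simp only [Finset.mem_compl, Finset.mem_insert, Finset.mem_singleton, not_or] at hw
      obtain ⟨hwv, hwx, hwy⟩ := hw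
      have hvw := hv w (Ne.symm hwv)
      rw [principalMinor_quadruple _ (L2Structure.adjMatrix_self _) (fun a b => by
        rw [adjMatrix_rep_I, adjMatrix_rep_I, sgn_swap a b]; push_cast; ring)
        hwv hwx hwy hx hy hxy.ne]
      rw [(hv x hx).adjMatrix_rep, (hv y hy).adjMatrix_rep, hvw.adjMatrix_rep_symm,
        hxy.adjMatrix_rep]
      rcases R.dom_or_dom hwx with h1 | h1 <;> rcases R.dom_or_dom hwy with h2 | h2
      · rw [h1.adjMatrix_rep, h2.adjMatrix_rep]
        simp [ind, h1, h2.not_dom]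
      · rw [h1.adjMatrix_rep, h2.adjMatrix_rep_symm]
        simp [ind, h1, h2]
        ring_nf
      · rw [h1.adjMatrix_rep_symm, h2.adjMatrix_rep]
        simp [ind, h1.not_dom, h2.not_dom]
      · rw [h1.adjMatrix_rep_symm, h2.adjMatrix_rep_symm]
        simp [ind, h1.not_dom, h2]
    rw [Finset.sum_congr rfl e, ← Int.cast_sum, Finset.sum_add_distrib, ← Finset.mul_sum]
    congr 3
    · rw [Finset.sum_const, Finset.card_compl, L2Structure.card_triple hx hy hxy.ne]
      simp
    · refine (Finset.sum_subset (Finset.subset_univ _) fun w _ hw => ?_).symm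
      simp only [Finset.mem_compl, Finset.mem_insert, Finset.mem_singleton, not_not] at hw
      rcases hw with rfl | rfl | rfl
      · rw [hind0, zero_mul]
      · rw [ind_self, mul_zero]
      · rw [ind_self, zero_mul]
  by_cases hex : ∃ x y, v ≠ x ∧ R.Dom x y
  · obtain ⟨x₁, y₁, hx₁, hxy₁⟩ := hex
    refine ⟨∑ w, R.ind y₁ w * R.ind w x₁, fun x y hx hxy => ?_⟩
    have := (key x y hx hxy).trans (key x₁ y₁ hx₁ hxy₁).symm
    rw [Int.cast_inj] at this
    omega
  · exact ⟨0, fun x y hx hxy => absurd ⟨x, y, hx, hxy⟩ hex⟩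

theorem exists_hat_isomorphic {V : Type u} [Fintype V] {R : Tournament V} {v : V} (hv : ∀ y, v ≠ y → R.Dom v y) :
    ∃ (T : Tournament (Fin (Fintype.card V - 1))) (σ : V ≃ Option (Fin (Fintype.card V - 1))),
      σ v = none ∧ ∀ x y, R.Dom x y ↔ T.hat.Dom (σ x) (σ y) := by
  have hpos : 0 < Fintype.card V := Fintype.card_pos_iff.2 ⟨v⟩
  let σ₀ : V ≃ Option (Fin (Fintype.card V - 1)) := Fintype.equivOfCardEq (by
    rw [Fintype.card_option, Fintype.card_fin]; omega)
  -- The swap moves the image of `v` to `none`, the dominating vertex of `T.hat`.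
  let σ := σ₀.trans (Equiv.swap (σ₀ v) none)
  have hσ : σ v = none := by simp [σ]
  have hσ' : σ.symm none = v := by rw [← hσ, Equiv.symm_apply_apply]
  let T : Tournament (Fin (Fintype.card V - 1)) :=
    { Dom := fun a b => R.Dom (σ.symm (some a)) (σ.symm (some b))
      irrefl := fun a => R.irrefl _
      dom_iff := fun a b hab => R.dom_iff _ _ fun h => hab (Option.some_injective _
        (σ.symm.injective h)) }
  have key : ∀ a b, R.Dom (σ.symm a) (σ.symm b) ↔ T.hat.Dom a b := by
    rintro (_ | a) (_ | b)
    · rw [hσ']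
      exact iff_of_false (R.irrefl v) (T.hat.irrefl none)
    · rw [hσ']
      refine iff_of_true (hv _ fun h => ?_) trivial
      rw [h, Equiv.apply_symm_apply] at hσ
      exact Option.some_ne_none _ hσ
    · rw [hσ']
      refine iff_of_false (fun h => h.not_dom (hv _ h.ne.symm)) id
    · exact Iff.rfl
  refine ⟨T, σ, hσ, fun x y => ?_⟩
  rw [← key, Equiv.symm_apply_apply, Equiv.symm_apply_apply]

theorem exists_isDoublyRegular_of_cyclic {R : Tournament V} {v : V} (hv : ∀ y, v ≠ y → R.Dom v y)
    (hV : 7 ≤ Fintype.card V)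
    (h : (R.rep Complex.I).SpectrallyMonomorphic (Fintype.card V - 3)) {x y z : V}
    (hxy : R.Dom x y) (hyz : R.Dom y z) (hzx : R.Dom z x) :
    ∃ T : Tournament (Fin (Fintype.card V - 1)), T.IsDoublyRegular ∧ R.Isomorphic T.hat := by
  obtain ⟨T, σ, hσ, hT⟩ := exists_hat_isomorphic hv
  obtain ⟨d, hd⟩ := exists_sum_cyclic hv hV h
  refine ⟨T, isDoublyRegular_of_homogeneous (d := d) (by rw [Fintype.card_fin]; omega) ?_ ?_,
    σ, hT⟩
  -- `d ≠ 0`, because `z` closes a `3`-cycle on the arc from `x` to `y`, which avoids `v`.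
  · rw [← hd x y ?_ hxy]
    · refine (lt_of_lt_of_le ?_ (Finset.single_le_sum
        (fun w _ => mul_nonneg (ind_nonneg y w) (ind_nonneg w x)) (Finset.mem_univ z))).ne'
      simp [ind, hyz, hzx]
    · rintro rfl
      exact hzx.not_dom (hv z hzx.ne.symm)
  · intro a b hab
    have hv' : v ≠ σ.symm (some a) := by
      intro e
      rw [e, Equiv.apply_symm_apply] at hσ
      exact Option.some_ne_none _ hσ
    have hab' : R.Dom (σ.symm (some a)) (σ.symm (some b)) := by
      rw [hT, Equiv.apply_symm_apply, Equiv.apply_symm_apply]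
      exact hab
    -- Nothing dominates `v`, so `v` lies in no `3`-cycle and its term drops out: the counts in `R`
    -- and in `T` agree.
    rw [← hd _ _ hv' hab', ← Equiv.sum_comp σ.symm, Fintype.sum_option]
    have hσ' : σ.symm none = v := by rw [← hσ, Equiv.symm_apply_apply]
    have h0 : R.ind (σ.symm (some b)) v = 0 := if_neg fun h => h.not_dom (hv _ h.ne.symm)
    have hind : ∀ p q, T.ind p q = R.ind (σ.symm (some p)) (σ.symm (some q)) := by
      intro p q
      refine ind_congr ?_
      rw [hT, Equiv.apply_symm_apply, Equiv.apply_symm_apply]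
      exact Iff.rfl
    rw [hσ', h0, zero_mul, zero_add]
    simp only [hind]

end Forward

end Tournament

/-! ### Assembling the classification -/

theorem L2Structure.SpectrallyMonomorphic.inList {V : Type u} [Fintype V] [DecidableEq V]
    {g : L2Structure V ℂ} (hg : g.IsHermitian) (hV : 7 ≤ Fintype.card V)
    (h : g.SpectrallyMonomorphic (Fintype.card V - 3)) : g.InList := by
  obtain ⟨v⟩ : Nonempty V := Fintype.card_pos_iff.1 (by omega)
  rcases h.exists_rep hg (by omega) v with h1 | ⟨c, R, hc, hc0, hv, hgR⟩
  · exact Or.inl h1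
  · by_cases hR : R.IsTransitive
    · exact Or.inr (Or.inl ⟨c, R, hc, hc0.ne', hR, hgR⟩)
    · obtain ⟨x, y, z, hxy, hyz, hzx⟩ := Tournament.exists_cyclic_of_not_isTransitive hR
      have h2 := (hgR.spectrallyMonomorphic_iff _).2 h
      obtain rfl := Tournament.eq_I_of_cyclic hc hc0 hv (by omega) h2 hxy hyz hzx
      obtain ⟨T, hT, hRT⟩ := Tournament.exists_isDoublyRegular_of_cyclic hv hV h2 hxy hyz hzx
      exact Or.inr (Or.inr ⟨T, R, hT, hRT, hgR⟩)

theorem mainTheorem2 {V : Type u} [Fintype V] [DecidableEq V] (n : ℕ) (hV : Fintype.card V = n)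
    (hn : 6 ≤ n) (g : L2Structure V ℂ) (hg : g.IsHermitian) :
    (7 ≤ n → (g.SpectrallyMonomorphic (n - 3) ↔ g.InList)) ∧
      (g.InList → g.SpectrallyMonomorphic (n - 3)) := by
  subst hV
  have h : g.InList → g.SpectrallyMonomorphic (Fintype.card V - 3) := fun h =>
    h.spectrallyMonomorphic (by omega)
  exact ⟨fun h7 => ⟨fun h1 => h1.inList hg h7, h⟩, h⟩
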